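/- Work in $\mathrm{ZFC}$, with $V$ the universe of all sets. Let $U$ be a normal ultrafilter on a measurable cardinal $\delta$, that is, a nonprincipal $\delta$-complete ultrafilter on the uncountable cardinal $\delta$ that is closed under diagonal intersections. Let $\mathrm{Ult}(V,U)$ be the transitive collapse of the ultrapower of $V$ by $U$, and let $j_U:V\to\mathrm{Ult}(V,U)$ be the corresponding elementary embedding. A set $A$ of ordinals is called fresh over a class $M$ if $A\notin M$ and $A\cap\alpha\in M$ for every ordinal $\alpha$ smaller than the least upper bound of $A$. Then the following hold. (i) If $\kappa$ is the least cardinal $\kappa>\delta$ with $\mathcal{P}(\kappa)\not\subseteq\mathrm{Ult}(V,U)$, then there is an unbounded subset of $\kappa$ that is fresh over $\mathrm{Ult}(V,U)$. (ii) If $\lambda$ is a limit ordinal whose cofinality as computed in $\mathrm{Ult}(V,U)$ satisfies $\mathrm{cof}(\lambda)^{\mathrm{Ult}(V,U)}=j_U(\delta^+)$, then there is an unbounded subset of $\lambda$ that is fresh over $\mathrm{Ult}(V,U)$. (iii) If $2^\delta=\delta^+$ and $\lambda$ is a limit ordinal with $\mathrm{cof}(\lambda)=\delta^+$, then there is an unbounded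 subset of $\lambda$ that is fresh over $\mathrm{Ult}(V,U)$. -/

import Mathlib

universe u

noncomputable section

namespace MeasurableUltrapower

open Cardinal

/-- A normal ultrafilter on a measurable cardinal `δ`, where `δ` is identified with its set of
ordinals `{ξ | ξ < δ}`: a nonprincipal `δ`-complete ultrafilter on the uncountable cardinal `δ` that
is closed under diagonal intersections. (The measurability of `δ` is witnessed by the first four
fields.) -/
structure NormalUltrafilter (δ : Cardinal.{u}) where
  toUltrafilter : Ultrafilter δ.ord.ToType
  aleph0_lt : ℵ₀ < δ
  nonprincipal : ∀ ξ : δ.ord.ToType, {ξ} ∉ toUltrafilter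
  complete : CardinalInterFilter (toUltrafilter : Filter δ.ord.ToType) δ
  diagonal : ∀ X : δ.ord.ToType → Set δ.ord.ToType, (∀ η, X η ∈ toUltrafilter) →
    {ξ : δ.ord.ToType | ∀ η < ξ, ξ ∈ X η} ∈ toUltrafilter

namespace NormalUltrafilter

variable {δ : Cardinal.{u}} (U : NormalUltrafilter δ)

/-- The uncollapsed ultrapower of the universe `V` of all sets: functions from `δ` to `V` modulo
equality on a set in `U`. -/
abbrev Ultrapower : Type (u + 1) :=
  Filter.Germ (U.toUltrafilter : Filter δ.ord.ToType) ZFSet.{u}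

/-- The membership relation of the ultrapower: `[f] E [g]` iff `{ξ | f ξ ∈ g ξ} ∈ U`. -/
def E (p q : U.Ultrapower) : Prop :=
  Filter.Germ.LiftRel (fun x y : ZFSet.{u} => x ∈ y) p q

theorem wellFounded_E : WellFounded U.E := by
  have := U.complete
  have : CountableInterFilter (U.toUltrafilter : Filter δ.ord.ToType) :=
    CardinalInterFilter.toCountableInterFilter _ U.aleph0_lt
  rw [wellFounded_iff_isEmpty_descending_chain]
  refine ⟨fun ⟨s, hs⟩ => ?_⟩
  choose f hf using fun n => Quotient.exists_rep (s n)
  have key : ∀ n, ∀ᶠ ξ in (U.toUltrafilter : Filter δ.ord.ToType), f (n + 1) ξ ∈ f n ξ := by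
    intro n
    have h := hs n
    rw [← hf n, ← hf (n + 1)] at h
    exact h
  obtain ⟨ξ, hξ⟩ := (eventually_countable_forall.2 key).exists
  exact (wellFounded_iff_isEmpty_descending_chain.1 ZFSet.mem_wf).false ⟨fun n => f n ξ, hξ⟩

instance small_E (q : U.Ultrapower) : Small.{u} {p : U.Ultrapower // U.E p q} := by
  induction q using Quotient.inductionOn with
  | h f =>
    let F : (∀ ξ, ↥(insert ∅ (f ξ) : ZFSet.{u})) → U.Ultrapower :=
      fun g => ((fun ξ => (g ξ : ZFSet.{u})) : δ.ord.ToType → ZFSet.{u})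
    have hF : Small.{u} (Set.range F) := small_range F
    suffices hsub : {p | U.E p (Quotient.mk _ f)} ⊆ Set.range F from small_subset hsub
    intro p hp
    induction p using Quotient.inductionOn with
    | h g =>
      classical
      have hp' : ∀ᶠ ξ in (U.toUltrafilter : Filter δ.ord.ToType), g ξ ∈ f ξ := hp
      refine ⟨fun ξ => if h : g ξ ∈ f ξ then ⟨g ξ, ZFSet.mem_insert_of_mem _ h⟩
        else ⟨∅, ZFSet.mem_insert _ _⟩, ?_⟩
      refine Filter.Germ.coe_eq.2 ?_
      filter_upwards [hp'] with ξ hξ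
      simp [hξ]

/-- The transitive (Mostowski) collapse of the ultrapower, `collapse q = {collapse p | p E q}`. -/
def collapse : U.Ultrapower → ZFSet.{u} :=
  U.wellFounded_E.fix fun q ih => ZFSet.range fun p : {p // U.E p q} => ih p.1 p.2

theorem mem_collapse {q : U.Ultrapower} {x : ZFSet.{u}} :
    x ∈ U.collapse q ↔ ∃ p, U.E p q ∧ U.collapse p = x := by
  rw [collapse, WellFounded.fix_eq, ZFSet.mem_range]
  simp

/-- The class `Ult(V, U)`: the transitive collapse of the ultrapower of `V` by `U`. -/
def Ult : Set ZFSet.{u} := Set.range U.collapse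

/-- The elementary embedding `j_U : V → Ult(V, U)`, sending `x` to the collapse of the class of the
constant function with value `x`. -/
def j (x : ZFSet.{u}) : ZFSet.{u} :=
  U.collapse ((fun _ => x : δ.ord.ToType → ZFSet.{u}) : U.Ultrapower)

end NormalUltrafilter

/-- A set `A` of ordinals is fresh over the class `M` if `A ∉ M` and `A ∩ α ∈ M` for every ordinal
`α` below the least upper bound of `A`; the least upper bound of a set of von Neumann ordinals is
its union. -/
def FreshOver (M : Set ZFSet.{u}) (A : ZFSet.{u}) : Prop :=
  (∀ x ∈ A, x.IsOrdinal) ∧ A ∉ M ∧ ∀ α ∈ (ZFSet.sUnion A : ZFSet.{u}), A ∩ α ∈ M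

/-- `A` is an unbounded subset of the (von Neumann) ordinal `l`. -/
def IsUnboundedSubset (A l : ZFSet.{u}) : Prop :=
  A ⊆ l ∧ ∀ α ∈ l, ∃ β ∈ A, α ⊆ β

/-- `f` is a function from the ordinal `γ` to the ordinal `l` with range cofinal in `l`. -/
def IsCofinalMap (f γ l : ZFSet.{u}) : Prop :=
  ZFSet.IsFunc γ l f ∧ ∀ α ∈ l, ∃ β ∈ γ, ∃ η, ZFSet.pair β η ∈ f ∧ α ⊆ η

/-- `γ` is the cofinality of the ordinal `l` as computed in the transitive class `M`: the least
ordinal that is the domain of a cofinal map into `l` lying in `M`. -/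
def IsCofinalityIn (M : Set ZFSet.{u}) (l γ : ZFSet.{u}) : Prop :=
  γ ∈ M ∧ γ.IsOrdinal ∧ (∃ f ∈ M, IsCofinalMap f γ l) ∧
    ∀ β ∈ γ, ¬ ∃ f ∈ M, IsCofinalMap f β l

end MeasurableUltrapower

end

/-! Write M for Ult(V, U). A set of ordinals lies in M exactly when it is represented by a family of
classes S(ξ), ξ < δ (`Internal`), so the argument runs on representing functions. Normality makes M
closed under δ-sequences (`internal_of_mk_le`), and a diagonal argument gives δ⁺ ≤ j(δ) < j(δ⁺).

(i) Take x ⊆ κ outside M. For a < κ every subset of a is in M: by closure if |a| ≤ δ, otherwise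
because all subsets of μ = |a| are in M, hence so is the prewellorder of μ induced by a surjection μ
→ a, and M recovers the surjection as its rank function (`exists_represents_map`). So x is unbounded
and fresh.

(ii) j maps δ⁺ cofinally into j(δ⁺), so a cofinal map j(δ⁺) → λ in M yields an unbounded A ⊆ λ whose
proper initial segments have size at most δ, hence lie in M. If A were in M, M would see at most
j(δ) elements in it (`Represents.eventually_mk_le`): otherwise A has an element at position δ⁺ <
j(δ⁺), with δ⁺ predecessors. Then M has a cofinal map j(δ) → λ, against the choice of j(δ⁺).

(iii) Let A be cofinal in λ of type δ⁺. If nothing is fresh, every subset of A is in M. As |j(δ⁺)| ≤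
(δ⁺)^δ = δ⁺, some surjection A → j(δ⁺) exists and lies in M, while M thinks A has size at most j(δ):
a contradiction. -/

noncomputable section

namespace MeasurableUltrapower

open Cardinal Filter

/-! ### Membership, pairs and ordinals in the ultrapower -/

namespace NormalUltrafilter

variable {δ : Cardinal.{u}} (U : NormalUltrafilter δ)

/-- The filter on `δ` underlying a normal ultrafilter. -/
abbrev filter : Filter δ.ord.ToType := (U.toUltrafilter : Filter δ.ord.ToType)

/-- The element of `Ult(V, U)` represented by the function `F`. -/
def coll (F : δ.ord.ToType → ZFSet.{u}) : ZFSet.{u} :=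
  U.collapse (F : U.Ultrapower)

theorem mem_coll {F : δ.ord.ToType → ZFSet.{u}} {x : ZFSet.{u}} :
    x ∈ U.coll F ↔ ∃ G, (∀ᶠ ξ in U.filter, G ξ ∈ F ξ) ∧ U.coll G = x := by
  rw [coll, mem_collapse]
  constructor
  · rintro ⟨p, hp, rfl⟩
    induction p using Quotient.inductionOn with
    | h G => exact ⟨G, hp, rfl⟩
  · rintro ⟨G, hG, rfl⟩
    exact ⟨(G : U.Ultrapower), hG, rfl⟩

theorem mem_Ult {x : ZFSet.{u}} : x ∈ U.Ult ↔ ∃ F, U.coll F = x := by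
  constructor
  · rintro ⟨p, rfl⟩
    induction p using Quotient.inductionOn with
    | h G => exact ⟨G, rfl⟩
  · rintro ⟨G, rfl⟩
    exact ⟨_, rfl⟩

theorem coll_mem_Ult (F : δ.ord.ToType → ZFSet.{u}) : U.coll F ∈ U.Ult :=
  U.mem_Ult.2 ⟨F, rfl⟩

theorem coll_congr {F G : δ.ord.ToType → ZFSet.{u}} (h : ∀ᶠ ξ in U.filter, F ξ = G ξ) :
    U.coll F = U.coll G :=
  congrArg U.collapse (Germ.coe_eq.2 h)

/-- The ultrapower is extensional: where F and G differ, H picks an element of exactly one of them,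
so the class of H separates theirs. -/
theorem collapse_injective : Function.Injective U.collapse := by
  intro p
  induction p using U.wellFounded_E.induction with
  | _ p ih =>
  intro q hpq
  have hE : ∀ r, U.E r p ↔ U.E r q := by
    intro r
    constructor
    · intro hr
      obtain ⟨s, hs, hsr⟩ := U.mem_collapse.1 (hpq ▸ U.mem_collapse.2 ⟨r, hr, rfl⟩)
      rwa [ih r hr hsr.symm]
    · intro hr
      obtain ⟨s, hs, hsr⟩ := U.mem_collapse.1 (hpq.symm ▸ U.mem_collapse.2 ⟨r, hr, rfl⟩)
      rwa [← ih s hs hsr]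
  clear ih hpq
  induction p using Quotient.inductionOn with
  | h F =>
  induction q using Quotient.inductionOn with
  | h G =>
  refine Germ.coe_eq.2 ?_
  by_contra hne
  have hne' : ∀ᶠ ξ in U.filter, F ξ ≠ G ξ := Ultrafilter.eventually_not.2 hne
  have hw : ∀ ξ, ∃ x, F ξ ≠ G ξ → ¬ (x ∈ F ξ ↔ x ∈ G ξ) := by
    intro ξ
    by_contra! h
    exact (h ∅).1 (ZFSet.ext fun x => (h x).2)
  choose H hH using hw
  have h1 : (∀ᶠ ξ in U.filter, H ξ ∈ F ξ) ↔ ∀ᶠ ξ in U.filter, H ξ ∈ G ξ := hE (H : U.Ultrapower)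
  have h2 : ∀ᶠ ξ in U.filter, ¬ (H ξ ∈ F ξ ↔ H ξ ∈ G ξ) := hne'.mono hH
  by_cases h3 : ∀ᶠ ξ in U.filter, H ξ ∈ F ξ
  · obtain ⟨ξ, h⟩ := (h2.and (h3.and (h1.1 h3))).exists
    exact h.1 (iff_of_true h.2.1 h.2.2)
  · obtain ⟨ξ, h⟩ := (h2.and ((Ultrafilter.eventually_not.2 h3).and
      (Ultrafilter.eventually_not.2 (mt h1.2 h3)))).exists
    exact h.1 (iff_of_false h.2.1 h.2.2)

theorem coll_eq_iff {F G : δ.ord.ToType → ZFSet.{u}} :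
    U.coll F = U.coll G ↔ ∀ᶠ ξ in U.filter, F ξ = G ξ :=
  U.collapse_injective.eq_iff.trans Germ.coe_eq

theorem coll_mem_iff {F G : δ.ord.ToType → ZFSet.{u}} :
    U.coll F ∈ U.coll G ↔ ∀ᶠ ξ in U.filter, F ξ ∈ G ξ := by
  rw [mem_coll]
  constructor
  · rintro ⟨H, hH, e⟩
    filter_upwards [hH, U.coll_eq_iff.1 e] with ξ h1 h2
    rwa [← h2]
  · exact fun h => ⟨F, h, rfl⟩

theorem coll_insert_singleton (F G : δ.ord.ToType → ZFSet.{u}) :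
    U.coll (fun ξ => {F ξ, G ξ}) = {U.coll F, U.coll G} := by
  ext x
  simp only [mem_coll, ZFSet.mem_pair, Ultrafilter.eventually_or, ← coll_eq_iff]
  constructor
  · rintro ⟨H, h | h, rfl⟩ <;> simp [h]
  · rintro (rfl | rfl)
    · exact ⟨F, Or.inl rfl, rfl⟩
    · exact ⟨G, Or.inr rfl, rfl⟩

theorem coll_pair (F G : δ.ord.ToType → ZFSet.{u}) :
    U.coll (fun ξ => ZFSet.pair (F ξ) (G ξ)) = ZFSet.pair (U.coll F) (U.coll G) := by
  have h := U.coll_insert_singleton F F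
  simp only [ZFSet.pair_eq_singleton] at h
  simp only [ZFSet.pair, coll_insert_singleton, h]

/-- The ordinal of `Ult(V, U)` represented by an ordinal-valued function. -/
def ordVal (f : δ.ord.ToType → Ordinal.{u}) : Ordinal.{u} :=
  (U.coll fun ξ => (f ξ).toZFSet).rank

theorem mem_coll_toZFSet {f : δ.ord.ToType → Ordinal.{u}} {x : ZFSet.{u}} :
    x ∈ U.coll (fun ξ => (f ξ).toZFSet) ↔
      ∃ g : δ.ord.ToType → Ordinal.{u}, (∀ᶠ ξ in U.filter, g ξ < f ξ) ∧
        U.coll (fun ξ => (g ξ).toZFSet) = x := by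
  rw [mem_coll]
  constructor
  · rintro ⟨G, hG, rfl⟩
    refine ⟨fun ξ => (G ξ).rank, ?_, U.coll_congr ?_⟩
    · filter_upwards [hG] with ξ h
      simpa using ZFSet.rank_lt_of_mem h
    · filter_upwards [hG] with ξ h
      exact ((ZFSet.isOrdinal_toZFSet _).mem h).toZFSet_rank_eq
  · rintro ⟨g, hg, rfl⟩
    exact ⟨_, hg.mono fun ξ h => Ordinal.toZFSet_mem_toZFSet_iff.2 h, rfl⟩

theorem coll_toZFSet (f : δ.ord.ToType → Ordinal.{u}) :
    U.coll (fun ξ => (f ξ).toZFSet) = (U.ordVal f).toZFSet := by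
  have htr : ∀ f : δ.ord.ToType → Ordinal.{u},
      (U.coll fun ξ => (f ξ).toZFSet).IsTransitive := by
    intro f x hx y hy
    obtain ⟨g, hg, rfl⟩ := U.mem_coll_toZFSet.1 hx
    obtain ⟨h, hh, rfl⟩ := U.mem_coll_toZFSet.1 hy
    exact U.mem_coll_toZFSet.2 ⟨h, hh.mp (hg.mono fun ξ a b => b.trans a), rfl⟩
  refine (ZFSet.IsOrdinal.toZFSet_rank_eq ?_).symm
  rw [ZFSet.isOrdinal_iff_forall_mem_isTransitive]
  refine ⟨htr f, fun y hy => ?_⟩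
  obtain ⟨g, -, rfl⟩ := U.mem_coll_toZFSet.1 hy
  exact htr g

theorem ordVal_lt_iff {f g : δ.ord.ToType → Ordinal.{u}} :
    U.ordVal f < U.ordVal g ↔ ∀ᶠ ξ in U.filter, f ξ < g ξ := by
  rw [← Ordinal.toZFSet_mem_toZFSet_iff, ← coll_toZFSet, ← coll_toZFSet, coll_mem_iff]
  simp only [Ordinal.toZFSet_mem_toZFSet_iff]

theorem ordVal_eq_iff {f g : δ.ord.ToType → Ordinal.{u}} :
    U.ordVal f = U.ordVal g ↔ ∀ᶠ ξ in U.filter, f ξ = g ξ := by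
  rw [← Ordinal.toZFSet_injective.eq_iff, ← coll_toZFSet, ← coll_toZFSet, coll_eq_iff]
  simp only [Ordinal.toZFSet_injective.eq_iff]

theorem ordVal_le_iff {f g : δ.ord.ToType → Ordinal.{u}} :
    U.ordVal f ≤ U.ordVal g ↔ ∀ᶠ ξ in U.filter, f ξ ≤ g ξ := by
  rw [← not_lt, ordVal_lt_iff, ← Ultrafilter.eventually_not]
  simp only [not_lt]

theorem exists_ordVal_of_lt {f : δ.ord.ToType → Ordinal.{u}} {a : Ordinal.{u}}
    (h : a < U.ordVal f) :
    ∃ g : δ.ord.ToType → Ordinal.{u}, (∀ᶠ ξ in U.filter, g ξ < f ξ) ∧ U.ordVal g = a := by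
  rw [← Ordinal.toZFSet_mem_toZFSet_iff, ← coll_toZFSet, mem_coll_toZFSet] at h
  obtain ⟨g, hg, e⟩ := h
  rw [coll_toZFSet] at e
  exact ⟨g, hg, Ordinal.toZFSet_injective e⟩

/-- The action of `j_U` on ordinals. -/
def jOrd (a : Ordinal.{u}) : Ordinal.{u} := U.ordVal fun _ => a

theorem jOrd_strictMono : StrictMono U.jOrd := fun _ _ h =>
  U.ordVal_lt_iff.2 (Eventually.of_forall fun _ => h)

theorem j_toZFSet (a : Ordinal.{u}) : U.j a.toZFSet = (U.jOrd a).toZFSet :=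
  U.coll_toZFSet fun _ => a

/-- Since a < a + 1 ≤ j(a + 1), a lies below a represented ordinal. -/
theorem exists_ordVal (a : Ordinal.{u}) : ∃ f, U.ordVal f = a := by
  have h : a < U.jOrd (Order.succ a) :=
    (Order.lt_succ a).trans_le (U.jOrd_strictMono.le_apply)
  obtain ⟨g, -, hg⟩ := U.exists_ordVal_of_lt h
  exact ⟨g, hg⟩

/-! ### Sets of ordinals in the ultrapower -/

/-- The family `S` represents the class of ordinals `A`. -/
def Represents (S : δ.ord.ToType → Set Ordinal.{u}) (A : Set Ordinal.{u}) : Prop :=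
  ∀ f, U.ordVal f ∈ A ↔ ∀ᶠ ξ in U.filter, f ξ ∈ S ξ

/-- A class of ordinals is internal if it is represented by a family of classes of ordinals. -/
def Internal (A : Set Ordinal.{u}) : Prop :=
  ∃ S, U.Represents S A

theorem mem_Ult_iff_internal {A : ZFSet.{u}} {l : Ordinal.{u}} (hA : A ⊆ l.toZFSet) :
    A ∈ U.Ult ↔ U.Internal {a | a.toZFSet ∈ A} := by
  constructor
  · intro h
    obtain ⟨F, rfl⟩ := U.mem_Ult.1 h
    refine ⟨fun ξ => {a | a.toZFSet ∈ F ξ}, fun f => ?_⟩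
    rw [Set.mem_ofPred_eq, ← coll_toZFSet, coll_mem_iff]
    rfl
  · rintro ⟨S, hS⟩
    obtain ⟨m, rfl⟩ := U.exists_ordVal l
    rw [← coll_toZFSet] at hA
    -- The classes S(ξ) may be proper; cutting at m(ξ), where m represents the bound l, turns them
    -- into sets.
    refine U.mem_Ult.2 ⟨fun ξ => (m ξ).toZFSet.sep fun x => x.rank ∈ S ξ, ?_⟩
    ext x
    rw [mem_coll]
    constructor
    · rintro ⟨G, hG, rfl⟩
      have hm : U.coll G ∈ U.coll fun ξ => (m ξ).toZFSet :=
        U.coll_mem_iff.2 (hG.mono fun ξ h => (ZFSet.mem_sep.1 h).1)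
      obtain ⟨g, -, e⟩ := U.mem_coll_toZFSet.1 hm
      rw [← e, coll_toZFSet]
      refine (hS g).2 ?_
      filter_upwards [hG, U.coll_eq_iff.1 e] with ξ h1 h2
      simpa [← h2] using (ZFSet.mem_sep.1 h1).2
    · intro hx
      obtain ⟨g, hg, rfl⟩ := U.mem_coll_toZFSet.1 (hA hx)
      refine ⟨_, ?_, rfl⟩
      rw [coll_toZFSet] at hx
      filter_upwards [hg, (hS g).1 hx] with ξ h1 h2
      simpa using ⟨h1, h2⟩

end NormalUltrafilter

/-! ### Closure under δ-sequences, and δ⁺ < j(δ⁺) -/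

theorem exists_subset_range {δ : Cardinal.{u}} {S : Set Ordinal.{u}} (h0 : δ ≠ 0)
    (h : #S ≤ lift.{u + 1} δ) : ∃ e : δ.ord.ToType → Ordinal.{u}, S ⊆ Set.range e := by
  have : Nonempty δ.ord.ToType := by simpa [Ordinal.nonempty_toType_iff] using h0
  rw [← mk_ord_toType δ, ← lift_id'.{u, u + 1} #S, lift_mk_le'.{u + 1, u}] at h
  obtain ⟨i⟩ := h
  by_cases hS : Nonempty S
  · refine ⟨fun x => (Function.invFun i x : S), fun x hx => ⟨i ⟨x, hx⟩, ?_⟩⟩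
    simp [Function.leftInverse_invFun i.injective _]
  · rw [Set.nonempty_coe_sort, Set.not_nonempty_iff_eq_empty] at hS
    exact ⟨fun _ => 0, by simp [hS]⟩

namespace NormalUltrafilter

variable {δ : Cardinal.{u}} (U : NormalUltrafilter δ)

theorem countableInterFilter : CountableInterFilter U.filter :=
  have := U.complete
  CardinalInterFilter.toCountableInterFilter U.filter U.aleph0_lt

theorem ne_zero {δ : Cardinal.{u}} (U : NormalUltrafilter δ) : δ ≠ 0 := (aleph0_pos.trans U.aleph0_lt).ne'

theorem eventually_gt (η : δ.ord.ToType) : ∀ᶠ ξ in U.filter, η < ξ := by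
  have := U.complete
  have hc : #(Set.Iic η) < δ := by
    have := mk_Iic_lt η (by simp) (by simpa using U.aleph0_lt.le)
    simpa using this
  have h : ∀ᶠ ξ in U.filter, ∀ x, ∀ _ : x ∈ Set.Iic η, ξ ≠ x :=
    (eventually_cardinal_ball hc).2 fun x _ =>
      Ultrafilter.compl_mem_iff_notMem.2 (U.nonprincipal x)
  filter_upwards [h] with ξ hξ
  exact lt_of_not_ge fun hle => hξ ξ hle rfl

/-- Normality in pressing-down form: a regressive choice of η is constant on a set in U. -/
theorem exists_eventually_of_eventually_exists_lt {p : δ.ord.ToType → δ.ord.ToType → Prop}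
    (h : ∀ᶠ ξ in U.filter, ∃ η < ξ, p η ξ) : ∃ η, ∀ᶠ ξ in U.filter, p η ξ := by
  by_contra hc
  rw [not_exists] at hc
  have hd : ∀ᶠ ξ in U.filter, ∀ η < ξ, ¬ p η ξ :=
    U.diagonal (fun η => {ξ | ¬ p η ξ}) fun η => Ultrafilter.eventually_not.2 (hc η)
  obtain ⟨ξ, ⟨η, hη, h1⟩, h2⟩ := (h.and hd).exists
  exact h2 η hη h1

/-- `Ult(V, U)` is closed under sequences of length `δ`, for sets of ordinals. -/
theorem internal_of_subset_range {A : Set Ordinal.{u}} {e : δ.ord.ToType → Ordinal.{u}}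
    (h : A ⊆ Set.range e) : U.Internal A := by
  choose f hf using fun η => U.exists_ordVal (e η)
  -- Only indices η < ξ enter at ξ: each η enters eventually, and pressing down recovers a single η
  -- from membership.
  refine ⟨fun ξ => {x | ∃ η < ξ, e η ∈ A ∧ x = f η ξ}, fun g => ⟨fun hg => ?_, fun hg => ?_⟩⟩
  · obtain ⟨η, hη⟩ := h hg
    rw [← hη] at hg
    rw [← hf η, ordVal_eq_iff] at hη
    filter_upwards [hη, U.eventually_gt η] with ξ h1 h2
    exact ⟨η, h2, hg, h1.symm⟩
  · obtain ⟨η, hη⟩ := U.exists_eventually_of_eventually_exists_lt hg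
    have h1 : e η ∈ A := hη.exists.choose_spec.1
    rwa [U.ordVal_eq_iff.2 (hη.mono fun _ h => h.2), hf]

theorem internal_of_mk_le {A : Set Ordinal.{u}} (h : #A ≤ lift.{u + 1} δ) : U.Internal A :=
  have ⟨_, he⟩ := exists_subset_range U.ne_zero h
  U.internal_of_subset_range he

theorem exists_lt_ord_forall_ne (ξ : δ.ord.ToType) (h : δ.ord.ToType → Ordinal.{u}) :
    ∃ x < δ.ord, ∀ η < ξ, x ≠ h η := by
  by_contra! hc
  have h1 : Set.Iio δ.ord ⊆ h '' Set.Iio ξ := fun x hx => by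
    obtain ⟨η, h1, h2⟩ := hc x hx
    exact ⟨η, h1, h2.symm⟩
  have h2 := mk_le_mk_of_subset h1
  rw [mk_Iio_ordinal, card_ord] at h2
  have h3 : #(h '' Set.Iio ξ) ≤ lift.{u + 1} #(Set.Iio ξ) := by
    have := mk_image_le_lift (f := h) (s := Set.Iio ξ)
    rwa [lift_id'.{u, u + 1}] at this
  have h4 : #(Set.Iio ξ) < δ := by simpa using mk_Iio_lt ξ (by simp)
  exact (Cardinal.lift_le.1 (h2.trans h3)).not_gt h4

/-- Diagonalization: given δ functions f η, choose g(ξ) < δ different from f η ξ for all η < ξ; then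
[g] < j(δ) is none of the [f η]. -/
theorem succ_ord_le_jOrd : (Order.succ δ).ord ≤ U.jOrd δ.ord := by
  by_contra! hlt
  have hc : #(Set.Iio (U.jOrd δ.ord)) ≤ lift.{u + 1} δ := by
    rw [mk_Iio_ordinal, Cardinal.lift_le]
    exact Order.lt_succ_iff.1 (lt_ord.1 hlt)
  obtain ⟨e, he⟩ := exists_subset_range U.ne_zero hc
  choose f hf using fun η => U.exists_ordVal (e η)
  choose g hg hne using fun ξ => exists_lt_ord_forall_ne ξ fun η => f η ξ
  obtain ⟨η, hη⟩ := he (U.ordVal_lt_iff.2 (Eventually.of_forall hg) : U.ordVal g < U.jOrd δ.ord)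
  rw [← hf, ordVal_eq_iff] at hη
  obtain ⟨ξ, h1, h2⟩ := (hη.and (U.eventually_gt η)).exists
  exact hne ξ η h2 h1.symm

theorem succ_ord_lt_jOrd : (Order.succ δ).ord < U.jOrd (Order.succ δ).ord :=
  U.succ_ord_le_jOrd.trans_lt (U.jOrd_strictMono (ord_lt_ord.2 (Order.lt_succ δ)))

end NormalUltrafilter

/-! ### Transferring surjections into the ultrapower -/

theorem exists_rank_function {S : Set Ordinal.{u}} [Small.{u} S]
    {r : Ordinal.{u} → Ordinal.{u} → Prop} (hr : WellFounded fun a b : S => r a b) :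
    ∃ t : Ordinal.{u} → Ordinal.{u}, (∀ x ∈ S, ∀ y ∈ S, r y x → t y < t x) ∧
      ∀ x ∈ S, ∀ c < t x, ∃ y ∈ S, r y x ∧ c ≤ t y := by
  classical
  let i := equivShrink.{u} S
  let r' : Shrink.{u} S → Shrink.{u} S → Prop := fun a b => r (i.symm a) (i.symm b)
  have : IsWellFounded _ r' := ⟨InvImage.wf i.symm hr⟩
  let t : Ordinal.{u} → Ordinal.{u} := fun x =>
    if h : x ∈ S then IsWellFounded.rank r' (i ⟨x, h⟩) else 0
  have ht : ∀ x (h : x ∈ S), t x = IsWellFounded.rank r' (i ⟨x, h⟩) := fun x h => dif_pos h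
  refine ⟨t, fun x hx y hy hyx => ?_, fun x hx c hc => ?_⟩
  · rw [ht x hx, ht y hy]
    exact IsWellFounded.rank_lt_of_rel (by simpa [r'] using hyx)
  · rw [ht x hx, IsWellFounded.rank_eq, Ordinal.lt_iSup_iff] at hc
    obtain ⟨⟨b, hb⟩, hc⟩ := hc
    refine ⟨i.symm b, (i.symm b).2, by simpa [r'] using hb, ?_⟩
    rw [ht _ (i.symm b).2]
    simpa using Order.lt_succ_iff.1 hc

theorem exists_pairing_function {S : Set Ordinal.{u}} (hS : S.Infinite) :
    ∃ e : Ordinal.{u} → Ordinal.{u} → Ordinal.{u}, (∀ x ∈ S, ∀ y ∈ S, e x y ∈ S) ∧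
      ∀ x ∈ S, ∀ y ∈ S, ∀ x' ∈ S, ∀ y' ∈ S, e x y = e x' y' → x = x' ∧ y = y' := by
  classical
  have := hS.to_subtype
  have h : #(S × S) = #S := by rw [mk_prod, lift_id, mul_eq_self (aleph0_le_mk S)]
  obtain ⟨i⟩ := Cardinal.eq.1 h
  let e : Ordinal.{u} → Ordinal.{u} → Ordinal.{u} := fun x y =>
    if h : x ∈ S ∧ y ∈ S then i (⟨x, h.1⟩, ⟨y, h.2⟩) else 0
  have he : ∀ x (hx : x ∈ S) y (hy : y ∈ S), e x y = i (⟨x, hx⟩, ⟨y, hy⟩) :=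
    fun x hx y hy => dif_pos ⟨hx, hy⟩
  refine ⟨e, fun x hx y hy => ?_, fun x hx y hy x' hx' y' hy' h => ?_⟩
  · rw [he x hx y hy]
    exact Subtype.prop _
  · rw [he x hx y hy, he x' hx' y' hy', Subtype.coe_inj, i.injective.eq_iff] at h
    simpa using h

namespace NormalUltrafilter

variable {δ : Cardinal.{u}} {U : NormalUltrafilter δ}

/-- By countable completeness, representatives of countably many distinct elements are
simultaneously distinct and in S(ξ). Infinite S(ξ) then carry pairing functions. -/
theorem Represents.eventually_infinite {S : δ.ord.ToType → Set Ordinal.{u}} {A : Set Ordinal.{u}}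
    (h : U.Represents S A) (hA : A.Infinite) : ∀ᶠ ξ in U.filter, (S ξ).Infinite := by
  have := U.countableInterFilter
  let s := hA.natEmbedding
  choose F hF using fun n => U.exists_ordVal (s n)
  have h1 : ∀ᶠ ξ in U.filter, ∀ n, F n ξ ∈ S ξ :=
    eventually_countable_forall.2 fun n => (h (F n)).1 (hF n ▸ (s n).2)
  have h2 : ∀ᶠ ξ in U.filter, ∀ n m, F n ξ = F m ξ → n = m := by
    refine eventually_countable_forall.2 fun n => eventually_countable_forall.2 fun m => ?_
    by_cases hnm : n = m
    · simp [hnm]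
    · refine (Ultrafilter.eventually_not.2 (mt U.ordVal_eq_iff.2 ?_)).mono fun ξ h h' => (h h').elim
      rw [hF, hF, Subtype.coe_inj, s.injective.eq_iff]
      exact hnm
  filter_upwards [h1, h2] with ξ h1 h2
  exact Set.infinite_of_injective_forall_mem (fun n m => h2 n m) h1

theorem Represents.inter_Iio {S : δ.ord.ToType → Set Ordinal.{u}} {A : Set Ordinal.{u}}
    {m : δ.ord.ToType → Ordinal.{u}} (h : U.Represents S A) (hA : A ⊆ Set.Iio (U.ordVal m)) :
    U.Represents (fun ξ => S ξ ∩ Set.Iio (m ξ)) A := by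
  intro f
  refine ⟨fun hf => ?_, fun hf => (h f).2 (hf.mono fun _ h => h.1)⟩
  exact ((h f).1 hf).and (U.ordVal_lt_iff.1 (hA hf))

/-- If all subsets of `A` are internal, then so are all binary relations on `A`. -/
theorem exists_represents_rel {A : Set Ordinal.{u}} (hA : ∀ B ⊆ A, U.Internal B)
    (hinf : A.Infinite) (R : Ordinal.{u} → Ordinal.{u} → Prop) :
    ∃ r : δ.ord.ToType → Ordinal.{u} → Ordinal.{u} → Prop, ∀ f g, U.ordVal f ∈ A →
      U.ordVal g ∈ A → (R (U.ordVal f) (U.ordVal g) ↔ ∀ᶠ ξ in U.filter, r ξ (f ξ) (g ξ)) := by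
  obtain ⟨S, hS⟩ := hA A subset_rfl
  have he : ∀ ξ, ∃ e : Ordinal.{u} → Ordinal.{u} → Ordinal.{u}, (S ξ).Infinite →
      (∀ x ∈ S ξ, ∀ y ∈ S ξ, e x y ∈ S ξ) ∧ ∀ x ∈ S ξ, ∀ y ∈ S ξ, ∀ x' ∈ S ξ, ∀ y' ∈ S ξ,
        e x y = e x' y' → x = x' ∧ y = y' := fun ξ => by
    by_cases h : (S ξ).Infinite
    · obtain ⟨e, he⟩ := exists_pairing_function h
      exact ⟨e, fun _ => he⟩
    · exact ⟨fun _ _ => 0, fun h' => (h h').elim⟩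
  choose e he using he
  have he' := (hS.eventually_infinite hinf).mono he
  -- The pairing functions on the S(ξ) represent one on A, so R is coded by a subset of A, internal
  -- by hypothesis.
  let B : Set Ordinal.{u} := {b | ∃ f g, U.ordVal f ∈ A ∧ U.ordVal g ∈ A ∧
    R (U.ordVal f) (U.ordVal g) ∧ U.ordVal (fun ξ => e ξ (f ξ) (g ξ)) = b}
  have hB : B ⊆ A := by
    rintro _ ⟨f, g, hf, hg, -, rfl⟩
    refine (hS _).2 ?_
    filter_upwards [he', (hS f).1 hf, (hS g).1 hg] with ξ h1 h2 h3
    exact h1.1 _ h2 _ h3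
  obtain ⟨T, hT⟩ := hA B hB
  refine ⟨fun ξ x y => e ξ x y ∈ T ξ, fun f g hf hg => ?_⟩
  rw [← hT fun ξ => e ξ (f ξ) (g ξ)]
  constructor
  · exact fun h => ⟨f, g, hf, hg, h, rfl⟩
  · rintro ⟨f', g', hf', hg', h, heq⟩
    have : ∀ᶠ ξ in U.filter, f' ξ = f ξ ∧ g' ξ = g ξ := by
      filter_upwards [he', (hS f).1 hf, (hS g).1 hg, (hS f').1 hf', (hS g').1 hg',
        U.ordVal_eq_iff.1 heq] with ξ h h1 h2 h3 h4 h5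
      exact h.2 _ h3 _ h4 _ h1 _ h2 h5
    rwa [U.ordVal_eq_iff.2 (this.mono fun _ h => h.1),
      U.ordVal_eq_iff.2 (this.mono fun _ h => h.2)] at h

/-- If all subsets of `A` are internal, then so is every map from `A` onto an ordinal. -/
theorem exists_represents_map {A : Set Ordinal.{u}} (hA : ∀ B ⊆ A, U.Internal B)
    (hinf : A.Infinite) {l a : Ordinal.{u}} (hl : A ⊆ Set.Iio l)
    {t : Ordinal.{u} → Ordinal.{u}} (ht : t '' A = Set.Iio a) :
    ∃ T : δ.ord.ToType → Ordinal.{u} → Ordinal.{u}, ∀ f, U.ordVal f ∈ A →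
      U.ordVal (fun ξ => T ξ (f ξ)) = t (U.ordVal f) := by
  obtain ⟨S', hS'⟩ := hA A subset_rfl
  obtain ⟨m, rfl⟩ := U.exists_ordVal l
  have hS := hS'.inter_Iio hl
  set S : δ.ord.ToType → Set Ordinal.{u} := fun ξ => S' ξ ∩ Set.Iio (m ξ) with hSdef
  have hsmall : ∀ ξ, Small.{u} (S ξ) := fun ξ => small_subset Set.inter_subset_right
  obtain ⟨r, hr⟩ := exists_represents_rel hA hinf fun x y => t x < t y
  -- Descending sequences on a set in U would represent elements of A along which t strictly
  -- decreases.
  have hwf : ∀ᶠ ξ in U.filter, WellFounded fun a b : S ξ => r ξ a b := by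
    by_contra hc
    have hc' := Ultrafilter.eventually_not.2 hc
    have hs : ∀ ξ, ∃ s : ℕ → Ordinal.{u}, ¬ (WellFounded fun a b : S ξ => r ξ a b) →
        ∀ n, s n ∈ S ξ ∧ r ξ (s (n + 1)) (s n) := fun ξ => by
      by_cases h : WellFounded fun a b : S ξ => r ξ a b
      · exact ⟨fun _ => 0, fun h' => (h' h).elim⟩
      · rw [wellFounded_iff_isEmpty_descending_chain, not_isEmpty_iff] at h
        obtain ⟨s, hs⟩ := h
        exact ⟨fun n => s n, fun _ n => ⟨(s n).2, hs n⟩⟩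
    choose s hs using hs
    have hs' := hc'.mono hs
    have hmem : ∀ n, U.ordVal (fun ξ => s ξ n) ∈ A := fun n =>
      (hS _).2 (hs'.mono fun _ h => (h n).1)
    exact (wellFounded_iff_isEmpty_descending_chain.1
      (wellFounded_lt (α := Ordinal.{u}))).false ⟨fun n => t (U.ordVal fun ξ => s ξ n), fun n =>
        (hr _ _ (hmem _) (hmem _)).2 (hs'.mono fun _ h => (h n).2)⟩
  have hT : ∀ ξ, ∃ T : Ordinal.{u} → Ordinal.{u}, (WellFounded fun a b : S ξ => r ξ a b) →
      (∀ x ∈ S ξ, ∀ y ∈ S ξ, r ξ y x → T y < T x) ∧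
      ∀ x ∈ S ξ, ∀ c < T x, ∃ y ∈ S ξ, r ξ y x ∧ c ≤ T y := fun ξ => by
    by_cases h : WellFounded fun a b : S ξ => r ξ a b
    · obtain ⟨T, hT⟩ := exists_rank_function h
      exact ⟨T, fun _ => hT⟩
    · exact ⟨fun _ => 0, fun h' => (h h').elim⟩
  choose T hT using hT
  have hT' := hwf.mono hT
  refine ⟨T, fun f hf => ?_⟩
  generalize hb : t (U.ordVal f) = b
  -- The ranks T(ξ) represent t: both are rank functions of the same relation, and t skips no value
  -- because its image is an initial segment.
  induction b using WellFoundedLT.induction generalizing f with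
  | _ b ih =>
  apply le_antisymm
  · by_contra! hlt
    obtain ⟨g, hg, hgb⟩ := U.exists_ordVal_of_lt hlt
    have hy : ∀ ξ, ∃ y, (f ξ ∈ S ξ ∧ g ξ < T ξ (f ξ) ∧ WellFounded fun a b : S ξ => r ξ a b) →
        y ∈ S ξ ∧ r ξ y (f ξ) ∧ g ξ ≤ T ξ y := fun ξ => by
      by_cases h : f ξ ∈ S ξ ∧ g ξ < T ξ (f ξ) ∧ WellFounded fun a b : S ξ => r ξ a b
      · obtain ⟨y, hy⟩ := (hT ξ h.2.2).2 _ h.1 _ h.2.1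
        exact ⟨y, fun _ => hy⟩
      · exact ⟨0, fun h' => (h h').elim⟩
    choose y hy using hy
    have hy' := (((hS f).1 hf).and (hg.and hwf)).mono hy
    have hyA : U.ordVal y ∈ A := (hS y).2 (hy'.mono fun _ h => h.1)
    have hyb : t (U.ordVal y) < b := hb ▸ (hr y f hyA hf).2 (hy'.mono fun _ h => h.2.1)
    have hle := U.ordVal_le_iff.2 (hy'.mono fun _ h => h.2.2)
    rw [ih _ hyb y hyA rfl, hgb] at hle
    exact hle.not_gt hyb
  · refine le_of_forall_lt fun c hc => ?_
    have hca : c ∈ Set.Iio a := hc.trans (ht ▸ hb ▸ Set.mem_image_of_mem t hf : b ∈ Set.Iio a)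
    rw [← ht] at hca
    obtain ⟨x, hx, rfl⟩ := hca
    obtain ⟨g, rfl⟩ := U.exists_ordVal x
    rw [← ih _ hc g hx rfl, ordVal_lt_iff]
    filter_upwards [hT', (hr g f hx hf).1 (hb ▸ hc), (hS g).1 hx, (hS f).1 hf] with ξ h h1 h2 h3
    exact h.1 _ h3 _ h2 h1

/-- B is the t-image of its preimage in A; the preimage is internal by hypothesis, and t is
represented by T. -/
theorem internal_of_image_eq_Iio {A : Set Ordinal.{u}} (hA : ∀ B ⊆ A, U.Internal B)
    (hinf : A.Infinite) {l a : Ordinal.{u}} (hl : A ⊆ Set.Iio l)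
    {t : Ordinal.{u} → Ordinal.{u}} (ht : t '' A = Set.Iio a) {B : Set Ordinal.{u}}
    (hB : B ⊆ Set.Iio a) : U.Internal B := by
  obtain ⟨T, hT⟩ := exists_represents_map hA hinf hl ht
  obtain ⟨C, hC⟩ := hA {x ∈ A | t x ∈ B} (Set.sep_subset _ _)
  refine ⟨fun ξ => T ξ '' C ξ, fun g => ⟨fun hg => ?_, fun hg => ?_⟩⟩
  · obtain ⟨x, hx, hxg⟩ : U.ordVal g ∈ t '' A := ht ▸ hB hg
    obtain ⟨f, rfl⟩ := U.exists_ordVal x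
    have h1 := (hC f).1 ⟨hx, hxg ▸ hg⟩
    rw [← hT f hx, ordVal_eq_iff] at hxg
    filter_upwards [h1, hxg] with ξ h1 h2
    exact ⟨_, h1, h2⟩
  · have hx : ∀ ξ, ∃ x, g ξ ∈ T ξ '' C ξ → x ∈ C ξ ∧ T ξ x = g ξ := fun ξ => by
      by_cases h : g ξ ∈ T ξ '' C ξ
      · obtain ⟨x, hx⟩ := h
        exact ⟨x, fun _ => hx⟩
      · exact ⟨0, fun h' => (h h').elim⟩
    choose f hf using hx
    have hf' := hg.mono hf
    have h1 := (hC f).2 (hf'.mono fun _ h => h.1)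
    rw [← U.ordVal_eq_iff.2 (hf'.mono fun _ h => h.2), hT f h1.1]
    exact h1.2

end NormalUltrafilter

/-! ### Surjections, cofinal maps and the criterion for freshness -/

theorem exists_image_eq {A B : Set Ordinal.{u}} (hB : B.Nonempty) (h : #B ≤ #A) :
    ∃ t : Ordinal.{u} → Ordinal.{u}, t '' A = B := by
  classical
  have := hB.to_subtype
  obtain ⟨i⟩ := h
  let t : Ordinal.{u} → Ordinal.{u} := fun x =>
    if hx : x ∈ A then (Function.invFun i ⟨x, hx⟩ : B) else 0
  have ht : ∀ x (hx : x ∈ A), t x = (Function.invFun i ⟨x, hx⟩ : B) := fun x hx => dif_pos hx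
  refine ⟨t, Set.Subset.antisymm ?_ fun b hb => ⟨i ⟨b, hb⟩, (i ⟨b, hb⟩).2, ?_⟩⟩
  · rintro _ ⟨x, hx, rfl⟩
    rw [ht x hx]
    exact Subtype.prop _
  · rw [ht _ (i ⟨b, hb⟩).2]
    simp [Function.leftInverse_invFun i.injective _]

theorem exists_strictMonoOn_of_le_mk {S : Set Ordinal.{u}} {c : Cardinal.{u}}
    (h : lift.{u + 1} c ≤ #S) : ∃ e : Ordinal.{u} → Ordinal.{u},
      StrictMonoOn e (Set.Iio c.ord) ∧ Set.MapsTo e (Set.Iio c.ord) S := by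
  classical
  have hle : Ordinal.type (fun x y : Set.Iio c.ord => x < y) ≤
      Ordinal.type fun x y : S => x < y := by
    have h1 : Ordinal.type (fun x y : Set.Iio c.ord => x < y) = (lift.{u + 1} c).ord := by
      rw [Ordinal.type_lt_Iio, lift_ord]
    rw [h1, ord_le, Ordinal.card_type]
    exact h
  obtain ⟨i⟩ := Ordinal.type_le_iff'.1 hle
  let e : Ordinal.{u} → Ordinal.{u} := fun x => if hx : x < c.ord then i ⟨x, hx⟩ else 0
  have he : ∀ x (hx : x < c.ord), e x = i ⟨x, hx⟩ := fun x hx => dif_pos hx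
  refine ⟨e, fun x hx y hy hxy => ?_, fun x hx => ?_⟩
  · rw [he x hx, he y hy]
    exact i.map_rel_iff.2 hxy
  · rw [he x hx]
    exact Subtype.prop _

/-- A cofinal map between ordinals is the graph of a cofinal function on ordinals. -/
theorem isCofinalMap_toZFSet_iff {f : ZFSet.{u}} {c l : Ordinal.{u}} :
    IsCofinalMap f c.toZFSet l.toZFSet ↔ ∃ φ : Ordinal.{u} → Ordinal.{u}, (∀ b < c, φ b < l) ∧
      (∀ z, z ∈ f ↔ ∃ b < c, z = ZFSet.pair b.toZFSet (φ b).toZFSet) ∧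
      ∀ a < l, ∃ b < c, a ≤ φ b := by
  constructor
  · rintro ⟨⟨hf, hu⟩, hc⟩
    have h1 : ∀ b, ∃ y, b < c → y < l ∧ ∀ w, ZFSet.pair b.toZFSet w ∈ f ↔ w = y.toZFSet := by
      intro b
      by_cases hb : b < c
      · obtain ⟨w, hw, hw'⟩ := hu b.toZFSet (Ordinal.toZFSet_mem_toZFSet_iff.2 hb)
        obtain ⟨y, hy, rfl⟩ := Ordinal.mem_toZFSet_iff.1 (ZFSet.pair_mem_prod.1 (hf hw)).2
        exact ⟨y, fun _ => ⟨hy, fun w => ⟨hw' w, fun h => h ▸ hw⟩⟩⟩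
      · exact ⟨0, fun h => (hb h).elim⟩
    choose φ hφ using h1
    refine ⟨φ, fun b hb => (hφ b hb).1, fun z => ⟨fun hz => ?_, ?_⟩, fun a ha => ?_⟩
    · obtain ⟨x, hx, y, hy, rfl⟩ := ZFSet.mem_prod.1 (hf hz)
      obtain ⟨b, hb, rfl⟩ := Ordinal.mem_toZFSet_iff.1 hx
      exact ⟨b, hb, by rw [((hφ b hb).2 y).1 hz]⟩
    · rintro ⟨b, hb, rfl⟩
      exact ((hφ b hb).2 _).2 rfl
    · obtain ⟨x, hx, y, hy, hay⟩ := hc a.toZFSet (Ordinal.toZFSet_mem_toZFSet_iff.2 ha)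
      obtain ⟨b, hb, rfl⟩ := Ordinal.mem_toZFSet_iff.1 hx
      rw [((hφ b hb).2 y).1 hy, Ordinal.toZFSet_subset_toZFSet_iff] at hay
      exact ⟨b, hb, hay⟩
  · rintro ⟨φ, h1, h2, h3⟩
    refine ⟨⟨fun z hz => ?_, fun x hx => ?_⟩, fun x hx => ?_⟩
    · obtain ⟨b, hb, rfl⟩ := (h2 z).1 hz
      exact ZFSet.pair_mem_prod.2 ⟨Ordinal.toZFSet_mem_toZFSet_iff.2 hb,
        Ordinal.toZFSet_mem_toZFSet_iff.2 (h1 b hb)⟩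
    · obtain ⟨b, hb, rfl⟩ := Ordinal.mem_toZFSet_iff.1 hx
      refine ⟨_, (h2 _).2 ⟨b, hb, rfl⟩, fun w hw => ?_⟩
      obtain ⟨b', -, e⟩ := (h2 _).1 hw
      obtain ⟨e1, e2⟩ := ZFSet.pair_inj.1 e
      rw [e2, Ordinal.toZFSet_injective e1]
    · obtain ⟨a, ha, rfl⟩ := Ordinal.mem_toZFSet_iff.1 hx
      obtain ⟨b, hb, hab⟩ := h3 a ha
      exact ⟨_, Ordinal.toZFSet_mem_toZFSet_iff.2 hb, _, (h2 _).2 ⟨b, hb, rfl⟩,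
        Ordinal.toZFSet_subset_toZFSet_iff.2 hab⟩

/-- The set of von Neumann ordinals below `l` whose ranks lie in `A`. -/
def ordinalSet (l : Ordinal.{u}) (A : Set Ordinal.{u}) : ZFSet.{u} :=
  l.toZFSet.sep fun x => x.rank ∈ A

theorem toZFSet_mem_ordinalSet {l a : Ordinal.{u}} {A : Set Ordinal.{u}} :
    a.toZFSet ∈ ordinalSet l A ↔ a < l ∧ a ∈ A := by
  simp [ordinalSet]

theorem ordinalSet_subset (l : Ordinal.{u}) (A : Set Ordinal.{u}) :
    ordinalSet l A ⊆ l.toZFSet :=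
  fun _ h => (ZFSet.mem_sep.1 h).1

namespace NormalUltrafilter

variable {δ : Cardinal.{u}} {U : NormalUltrafilter δ}

theorem ordinalSet_mem_Ult_iff {l : Ordinal.{u}} {A : Set Ordinal.{u}} (hA : A ⊆ Set.Iio l) :
    ordinalSet l A ∈ U.Ult ↔ U.Internal A := by
  rw [U.mem_Ult_iff_internal (ordinalSet_subset l A)]
  simp only [toZFSet_mem_ordinalSet]
  rw [show {a | a < l ∧ a ∈ A} = A from Set.ext fun a => ⟨fun h => h.2, fun h => ⟨hA h, h⟩⟩]

theorem exists_fresh_of_not_internal {l : Ordinal.{u}} {A : Set Ordinal.{u}}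
    (hA : A ⊆ Set.Iio l) (hunb : ∀ a < l, ∃ b ∈ A, a ≤ b)
    (hint : ∀ a < l, U.Internal (A ∩ Set.Iio a)) (hn : ¬ U.Internal A) :
    ∃ A : ZFSet.{u}, IsUnboundedSubset A l.toZFSet ∧ FreshOver U.Ult A := by
  refine ⟨ordinalSet l A, ⟨ordinalSet_subset l A, fun x hx => ?_⟩,
    fun x hx => (ZFSet.isOrdinal_toZFSet l).mem (ordinalSet_subset l A hx),
    mt (ordinalSet_mem_Ult_iff hA).1 hn, fun x hx => ?_⟩
  · obtain ⟨a, ha, rfl⟩ := Ordinal.mem_toZFSet_iff.1 hx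
    obtain ⟨b, hb, hab⟩ := hunb a ha
    exact ⟨_, toZFSet_mem_ordinalSet.2 ⟨hA hb, hb⟩, Ordinal.toZFSet_subset_toZFSet_iff.2 hab⟩
  · obtain ⟨y, hy, hxy⟩ := ZFSet.mem_sUnion.1 hx
    obtain ⟨a, ha, rfl⟩ := Ordinal.mem_toZFSet_iff.1
      ((ZFSet.isOrdinal_toZFSet l).mem_trans hxy (ordinalSet_subset l A hy))
    have h := (ordinalSet_mem_Ult_iff (l := l) fun b hb => hA hb.1).2 (hint a ha)
    convert h using 1
    ext z
    rw [ZFSet.mem_inter]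
    constructor
    · rintro ⟨h1, h2⟩
      obtain ⟨b, hb, rfl⟩ := Ordinal.mem_toZFSet_iff.1 h2
      rw [toZFSet_mem_ordinalSet] at h1 ⊢
      exact ⟨h1.1, h1.2, hb⟩
    · intro h1
      obtain ⟨b, hb, rfl⟩ := Ordinal.mem_toZFSet_iff.1 (ordinalSet_subset _ _ h1)
      rw [toZFSet_mem_ordinalSet] at h1 ⊢
      exact ⟨⟨h1.1, h1.2.1⟩, Ordinal.toZFSet_mem_toZFSet_iff.2 h1.2.2⟩

/-- An internal set of ordinals whose proper initial segments have at most `δ` elements is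
represented by sets with at most `δ` elements. -/
theorem Represents.eventually_mk_le {S : δ.ord.ToType → Set Ordinal.{u}} {A : Set Ordinal.{u}}
    (hS : U.Represents S A) {l : Ordinal.{u}} (hA : A ⊆ Set.Iio l)
    (hseg : ∀ a < l, #↥(A ∩ Set.Iio a) ≤ lift.{u + 1} δ) :
    ∀ᶠ ξ in U.filter, #(S ξ) ≤ lift.{u + 1} δ := by
  by_contra hc
  have he : ∀ ξ, ∃ e : Ordinal.{u} → Ordinal.{u}, ¬ #(S ξ) ≤ lift.{u + 1} δ →
      StrictMonoOn e (Set.Iio (Order.succ δ).ord) ∧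
        Set.MapsTo e (Set.Iio (Order.succ δ).ord) (S ξ) := fun ξ => by
    by_cases h : #(S ξ) ≤ lift.{u + 1} δ
    · exact ⟨fun _ => 0, fun h' => (h' h).elim⟩
    · have h' : lift.{u + 1} (Order.succ δ) ≤ #(S ξ) := by
        rw [lift_succ]
        exact Order.succ_le_of_lt (not_le.1 h)
      obtain ⟨e, he⟩ := exists_strictMonoOn_of_le_mk h'
      exact ⟨e, fun _ => he⟩
  choose e he using he
  have he' := (Ultrafilter.eventually_not.2 hc).mono he
  -- d represents δ⁺ itself. The e(ξ) represent an increasing map j(δ⁺) → A, whose value at δ⁺ has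
  -- at least δ⁺ predecessors in A.
  obtain ⟨d, hd, hd'⟩ := U.exists_ordVal_of_lt U.succ_ord_lt_jOrd
  choose f hf using U.exists_ordVal
  have hmem : ∀ g : δ.ord.ToType → Ordinal.{u},
      (∀ᶠ ξ in U.filter, g ξ < (Order.succ δ).ord) → U.ordVal (fun ξ => e ξ (g ξ)) ∈ A :=
    fun g hg => (hS _).2 (by filter_upwards [he', hg] with ξ h1 h2 using h1.2 h2)
  have hlt : ∀ g h : δ.ord.ToType → Ordinal.{u}, (∀ᶠ ξ in U.filter, h ξ < (Order.succ δ).ord) →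
      U.ordVal g < U.ordVal h →
      U.ordVal (fun ξ => e ξ (g ξ)) < U.ordVal fun ξ => e ξ (h ξ) := fun g h h1 h2 => by
    rw [ordVal_lt_iff] at h2 ⊢
    filter_upwards [he', h1, h2] with ξ h3 h4 h5
    exact h3.1 (h5.trans h4) h4 h5
  have hfd : ∀ a < (Order.succ δ).ord, ∀ᶠ ξ in U.filter, f a ξ < (Order.succ δ).ord := by
    intro a ha
    have : U.ordVal (f a) < U.ordVal d := by rwa [hf, hd']
    filter_upwards [hd, U.ordVal_lt_iff.1 this] with ξ h1 h2 using h2.trans h1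
  let i : Set.Iio (Order.succ δ).ord →
      ↥(A ∩ Set.Iio (U.ordVal fun ξ => e ξ (d ξ))) := fun a =>
    ⟨U.ordVal fun ξ => e ξ (f a ξ), hmem _ (hfd a a.2), hlt _ _ hd (by rw [hf, hd']; exact a.2)⟩
  have hi : StrictMono i := fun a b hab =>
    hlt _ _ (hfd b b.2) (by rw [hf, hf]; exact hab)
  have hle := (mk_le_of_injective hi.injective).trans (hseg _ (hA (hmem d hd)))
  rw [mk_Iio_ordinal, card_ord, Cardinal.lift_le] at hle
  exact (Order.lt_succ δ).not_ge hle

end NormalUltrafilter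

/-! ### Part (i): the least κ with a missing subset -/

namespace NormalUltrafilter

variable {δ : Cardinal.{u}} {U : NormalUltrafilter δ}

theorem internal_of_subset_Iio {κ : Cardinal.{u}}
    (hκ : ∀ μ < κ, δ < μ → ∀ x ∈ μ.ord.toZFSet.powerset, x ∈ U.Ult) {a : Ordinal.{u}}
    (ha : a < κ.ord) {B : Set Ordinal.{u}} (hB : B ⊆ Set.Iio a) : U.Internal B := by
  by_cases hc : a.card ≤ δ
  · refine U.internal_of_mk_le ((mk_le_mk_of_subset hB).trans ?_)
    rwa [mk_Iio_ordinal, Cardinal.lift_le]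
  · rw [not_le] at hc
    have h0 : (Set.Iio a).Nonempty := by
      refine ⟨0, Set.mem_Iio.2 (pos_iff_ne_zero.2 ?_)⟩
      rintro rfl
      simp at hc
    have hall : ∀ C ⊆ Set.Iio a.card.ord, U.Internal C := fun C hC =>
      (ordinalSet_mem_Ult_iff hC).1
        (hκ _ (lt_ord.1 ha) hc _ (ZFSet.mem_powerset.2 (ordinalSet_subset _ _)))
    have hmk : #(Set.Iio a) = #(Set.Iio a.card.ord) := by
      rw [mk_Iio_ordinal, mk_Iio_ordinal, card_ord]
    have hinf : (Set.Iio a.card.ord).Infinite := by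
      rw [← Set.infinite_coe_iff, infinite_iff, mk_Iio_ordinal, card_ord, aleph0_le_lift]
      exact (U.aleph0_lt.trans hc).le
    obtain ⟨t, ht⟩ := exists_image_eq h0 hmk.le
    exact internal_of_image_eq_Iio hall hinf subset_rfl ht hB

theorem exists_fresh_of_isLeast {κ : Cardinal.{u}}
    (hκ : IsLeast {μ : Cardinal.{u} | δ < μ ∧ ¬ ∀ x ∈ μ.ord.toZFSet.powerset, x ∈ U.Ult} κ) :
    ∃ A : ZFSet.{u}, IsUnboundedSubset A κ.ord.toZFSet ∧ FreshOver U.Ult A := by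
  have hμ : ∀ μ < κ, δ < μ → ∀ x ∈ μ.ord.toZFSet.powerset, x ∈ U.Ult := fun μ h1 h2 => by
    by_contra h3
    exact (hκ.2 ⟨h2, h3⟩).not_gt h1
  obtain ⟨-, hx⟩ := hκ.1
  push Not at hx
  obtain ⟨x, hx, hxU⟩ := hx
  rw [ZFSet.mem_powerset] at hx
  have hn := mt (U.mem_Ult_iff_internal hx).2 hxU
  have hsub : {a : Ordinal.{u} | a.toZFSet ∈ x} ⊆ Set.Iio κ.ord := fun a ha =>
    Ordinal.toZFSet_mem_toZFSet_iff.1 (hx ha)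
  refine exists_fresh_of_not_internal hsub (fun a ha => ?_)
    (fun a ha => internal_of_subset_Iio hμ ha Set.inter_subset_right) hn
  by_contra! hc
  exact hn (internal_of_subset_Iio hμ ha hc)

/-! ### Part (ii): cofinality j(δ⁺) in the ultrapower -/

/-- `Ult(V, U)` is closed under restricting functions on ordinals to `j_U(a)`. -/
theorem exists_restrict_mem_Ult {f : ZFSet.{u}} (hf : f ∈ U.Ult) {c : Ordinal.{u}}
    {φ : Ordinal.{u} → Ordinal.{u}}
    (hφ : ∀ z, z ∈ f ↔ ∃ b < c, z = ZFSet.pair b.toZFSet (φ b).toZFSet)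
    {a : Ordinal.{u}} (ha : U.jOrd a ≤ c) :
    ∃ g ∈ U.Ult, ∀ z, z ∈ g ↔ ∃ b < U.jOrd a, z = ZFSet.pair b.toZFSet (φ b).toZFSet := by
  obtain ⟨F, rfl⟩ := U.mem_Ult.1 hf
  let G : δ.ord.ToType → ZFSet.{u} := fun ξ =>
    (F ξ).sep fun z => ∃ x ∈ a.toZFSet, ∃ y, z = ZFSet.pair x y
  have hsub : ∀ z, z ∈ U.coll G → z ∈ U.coll F := fun z hz => by
    obtain ⟨H, hH, rfl⟩ := U.mem_coll.1 hz
    exact U.coll_mem_iff.2 (hH.mono fun _ h => (ZFSet.mem_sep.1 h).1)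
  have hpair : ∀ b d : Ordinal.{u}, ZFSet.pair b.toZFSet d.toZFSet ∈ U.coll G ↔
      ZFSet.pair b.toZFSet d.toZFSet ∈ U.coll F ∧ b < U.jOrd a := by
    intro b d
    obtain ⟨b, rfl⟩ := U.exists_ordVal b
    obtain ⟨d, rfl⟩ := U.exists_ordVal d
    rw [← coll_toZFSet, ← coll_toZFSet, ← coll_pair, coll_mem_iff, coll_mem_iff, jOrd,
      ordVal_lt_iff, ← eventually_and]
    simp [G, ZFSet.pair_inj]
  refine ⟨_, U.coll_mem_Ult G, fun z => ⟨fun hz => ?_, ?_⟩⟩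
  · obtain ⟨b, -, rfl⟩ := (hφ z).1 (hsub z hz)
    exact ⟨b, ((hpair _ _).1 hz).2, rfl⟩
  · rintro ⟨b, hb, rfl⟩
    exact (hpair _ _).2 ⟨(hφ _).2 ⟨b, hb.trans_le ha, rfl⟩, hb⟩

/-- The element of `Ult(V, U)` represented by a family of functions on the ordinal `a` is a
function on `j_U(a)`. -/
theorem exists_graph_mem_Ult (U : NormalUltrafilter δ) (a : Ordinal.{u}) (K : δ.ord.ToType → Ordinal.{u} → Ordinal.{u}) :
    ∃ g ∈ U.Ult, ∃ φ : Ordinal.{u} → Ordinal.{u},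
      (∀ b, φ (U.ordVal b) = U.ordVal fun ξ => K ξ (b ξ)) ∧
      ∀ z, z ∈ g ↔ ∃ b < U.jOrd a, z = ZFSet.pair b.toZFSet (φ b).toZFSet := by
  choose r hr using U.exists_ordVal
  have hφ : ∀ b, U.ordVal (fun ξ => K ξ (r (U.ordVal b) ξ)) = U.ordVal fun ξ => K ξ (b ξ) :=
    fun b => U.ordVal_eq_iff.2 ((U.ordVal_eq_iff.1 (hr (U.ordVal b))).mono fun _ h => by rw [h])
  let G : δ.ord.ToType → ZFSet.{u} := fun ξ =>
    ZFSet.range fun i : Set.Iio a => ZFSet.pair i.1.toZFSet (K ξ i).toZFSet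
  refine ⟨_, U.coll_mem_Ult G, fun b => U.ordVal fun ξ => K ξ (r b ξ), hφ, fun z => ?_⟩
  rw [mem_coll]
  constructor
  · rintro ⟨H, hH, rfl⟩
    have h1 : ∀ ξ, ∃ b, H ξ ∈ G ξ → b < a ∧ H ξ = ZFSet.pair b.toZFSet (K ξ b).toZFSet :=
      fun ξ => by
        by_cases h : H ξ ∈ G ξ
        · obtain ⟨b, hb⟩ := ZFSet.mem_range.1 h
          exact ⟨b, fun _ => ⟨b.2, hb.symm⟩⟩
        · exact ⟨0, fun h' => (h h').elim⟩
    choose b hb using h1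
    have hb' := hH.mono hb
    refine ⟨U.ordVal b, U.ordVal_lt_iff.2 (hb'.mono fun _ h => h.1), ?_⟩
    rw [U.coll_congr (hb'.mono fun _ h => h.2), coll_pair, coll_toZFSet, coll_toZFSet, ← hφ]
  · rintro ⟨b, hb, rfl⟩
    refine ⟨fun ξ => ZFSet.pair (r b ξ).toZFSet (K ξ (r b ξ)).toZFSet, ?_, ?_⟩
    · rw [← hr b, jOrd, ordVal_lt_iff] at hb
      filter_upwards [hb] with ξ h
      exact ZFSet.mem_range.2 ⟨⟨_, h⟩, rfl⟩
    · rw [coll_pair, coll_toZFSet, coll_toZFSet, hr]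

/-- j is continuous at δ⁺: by regularity, a function δ → δ⁺ is bounded below δ⁺. -/
theorem exists_lt_succ_ord_of_lt_jOrd {b : Ordinal.{u}} (hb : b < U.jOrd (Order.succ δ).ord) :
    ∃ a < (Order.succ δ).ord, b < U.jOrd a := by
  obtain ⟨g, hg, rfl⟩ := U.exists_ordVal_of_lt hb
  have hreg := isRegular_succ U.aleph0_lt.le
  let g' : δ.ord.ToType → Ordinal.{u} := fun ξ => if g ξ < (Order.succ δ).ord then g ξ else 0
  have hg' : ∀ ξ, g' ξ < (Order.succ δ).ord := fun ξ => by
    by_cases h : g ξ < (Order.succ δ).ord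
    · simp [g', h]
    · simp [g', h]
  refine ⟨⨆ ξ, g' ξ + 1, Ordinal.iSup_add_one_lt_of_lt_cof ?_ hg', U.ordVal_lt_iff.2 ?_⟩
  · rw [hreg.cof_ord, mk_ord_toType]
    exact Order.lt_succ δ
  · filter_upwards [hg] with ξ h
    have h1 : g' ξ = g ξ := if_pos h
    rw [← h1, ← Order.add_one_le_iff]
    exact Ordinal.le_iSup (fun ξ => g' ξ + 1) ξ

theorem mk_image_Iio_le (h : Ordinal.{u} → Ordinal.{u}) {a : Ordinal.{u}}
    (ha : a < (Order.succ δ).ord) : #(h '' Set.Iio a) ≤ lift.{u + 1} δ := by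
  refine mk_image_le.trans ?_
  rw [mk_Iio_ordinal, Cardinal.lift_le]
  exact Order.lt_succ_iff.1 (lt_ord.1 ha)

theorem exists_fresh_of_isCofinalityIn {l : Ordinal.{u}} (hl : Order.IsSuccLimit l)
    (hcof : IsCofinalityIn U.Ult l.toZFSet (U.j (Order.succ δ).ord.toZFSet)) :
    ∃ A : ZFSet.{u}, IsUnboundedSubset A l.toZFSet ∧ FreshOver U.Ult A := by
  rw [j_toZFSet] at hcof
  obtain ⟨-, -, ⟨f, hf, hfc⟩, hmin⟩ := hcof
  obtain ⟨φ, hφl, hφ, hφc⟩ := isCofinalMap_toZFSet_iff.1 hfc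
  have hmin' : ∀ b < (Order.succ δ).ord,
      ¬ ∃ f ∈ U.Ult, IsCofinalMap f (U.jOrd b).toZFSet l.toZFSet :=
    fun b hb => hmin _ (Ordinal.toZFSet_mem_toZFSet_iff.2 (U.jOrd_strictMono hb))
  have hbdd : ∀ a < (Order.succ δ).ord, {b | b < l ∧ ∀ c < U.jOrd a, φ c ≤ b}.Nonempty := by
    intro a ha
    -- If φ were unbounded in l on j(a), its restriction, which is in the ultrapower, would be a
    -- cofinal map with domain below j(δ⁺).
    by_contra hc
    have hle := (U.jOrd_strictMono ha).le
    obtain ⟨g, hg, hgφ⟩ := exists_restrict_mem_Ult hf hφ hle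
    refine hmin' a ha ⟨g, hg, isCofinalMap_toZFSet_iff.2
      ⟨φ, fun b hb => hφl b (hb.trans_le hle), hgφ, fun b hb => ?_⟩⟩
    by_contra! h
    exact hc ⟨b, hb, fun c hc => (h c hc).le⟩
  let s : Ordinal.{u} → Ordinal.{u} := fun a => sInf {b | b < l ∧ ∀ c < U.jOrd a, φ c ≤ b}
  have hs : ∀ a < (Order.succ δ).ord, s a < l ∧ ∀ c < U.jOrd a, φ c ≤ s a :=
    fun a ha => csInf_mem (hbdd a ha)
  have hmono : ∀ a b, a ≤ b → b < (Order.succ δ).ord → s a ≤ s b := fun a b hab hb =>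
    csInf_le' ⟨(hs b hb).1, fun c hc =>
      (hs b hb).2 c (hc.trans_le (U.jOrd_strictMono.monotone hab))⟩
  have hAl : s '' Set.Iio (Order.succ δ).ord ⊆ Set.Iio l := by
    rintro _ ⟨a, ha, rfl⟩
    exact (hs a ha).1
  have hub : ∀ c < l, ∃ a < (Order.succ δ).ord, c ≤ s a := fun c hc => by
    obtain ⟨b, hb, hcb⟩ := hφc c hc
    obtain ⟨a, ha, hba⟩ := exists_lt_succ_ord_of_lt_jOrd hb
    exact ⟨a, ha, hcb.trans ((hs a ha).2 b hba)⟩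
  have hseg : ∀ c < l, #↥(s '' Set.Iio (Order.succ δ).ord ∩ Set.Iio c) ≤ lift.{u + 1} δ := by
    intro c hc
    obtain ⟨a, ha, hca⟩ := hub c hc
    refine (mk_le_mk_of_subset ?_).trans (mk_image_Iio_le s ha)
    rintro _ ⟨⟨b, hb, rfl⟩, hbc⟩
    exact ⟨b, lt_of_not_ge fun hab => (hca.trans (hmono a b hab hb)).not_gt hbc, rfl⟩
  refine exists_fresh_of_not_internal hAl (fun c hc => ?_)
    (fun c hc => U.internal_of_mk_le (hseg c hc)) ?_
  · obtain ⟨a, ha, hca⟩ := hub c hc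
    exact ⟨_, ⟨a, ha, rfl⟩, hca⟩
  -- If A is represented by S, then almost every S(ξ) is the image of δ under some K(ξ), and K
  -- represents a cofinal map from j(δ).
  rintro ⟨S, hS⟩
  have hle := Represents.eventually_mk_le hS hAl hseg
  have hne : ∀ᶠ ξ in U.filter, (S ξ).Nonempty := by
    obtain ⟨a, ha, -⟩ := hub 0 hl.bot_lt
    obtain ⟨h, hh⟩ := U.exists_ordVal (s a)
    exact ((hS h).1 (hh ▸ ⟨a, ha, rfl⟩)).mono fun ξ h => ⟨_, h⟩
  have hK : ∀ ξ, ∃ K : Ordinal.{u} → Ordinal.{u}, (S ξ).Nonempty ∧ #(S ξ) ≤ lift.{u + 1} δ →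
      K '' Set.Iio δ.ord = S ξ := fun ξ => by
    by_cases h : (S ξ).Nonempty ∧ #(S ξ) ≤ lift.{u + 1} δ
    · obtain ⟨K, hK⟩ := exists_image_eq (A := Set.Iio δ.ord) h.1
        (by rw [mk_Iio_ordinal, card_ord]; exact h.2)
      exact ⟨K, fun _ => hK⟩
    · exact ⟨fun _ => 0, fun h' => (h h').elim⟩
  choose K hK using hK
  have hK' := (hne.and hle).mono hK
  obtain ⟨g, hg, ψ, hψ, hgψ⟩ := U.exists_graph_mem_Ult δ.ord K
  refine hmin' δ.ord (ord_lt_ord.2 (Order.lt_succ δ)) ⟨g, hg, isCofinalMap_toZFSet_iff.2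
    ⟨ψ, fun b hb => hAl ?_, hgψ, fun c hc => ?_⟩⟩
  · obtain ⟨b, hb', rfl⟩ := U.exists_ordVal_of_lt hb
    rw [hψ]
    refine (hS _).2 ?_
    filter_upwards [hK', hb'] with ξ h1 h2
    exact h1 ▸ ⟨_, h2, rfl⟩
  · obtain ⟨a, ha, hca⟩ := hub c hc
    obtain ⟨x, hx⟩ := U.exists_ordVal (s a)
    have hxS := (hS x).1 (hx ▸ ⟨a, ha, rfl⟩)
    have hb : ∀ ξ, ∃ b, x ξ ∈ K ξ '' Set.Iio δ.ord → b < δ.ord ∧ K ξ b = x ξ := fun ξ => by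
      by_cases h : x ξ ∈ K ξ '' Set.Iio δ.ord
      · obtain ⟨b, hb⟩ := h
        exact ⟨b, fun _ => hb⟩
      · exact ⟨0, fun h' => (h h').elim⟩
    choose b hb using hb
    have hb' : ∀ᶠ ξ in U.filter, b ξ < δ.ord ∧ K ξ (b ξ) = x ξ := by
      filter_upwards [hK', hxS] with ξ h1 h2 using hb ξ (h1 ▸ h2)
    refine ⟨U.ordVal b, U.ordVal_lt_iff.2 (hb'.mono fun _ h => h.1), ?_⟩
    rwa [hψ, U.ordVal_eq_iff.2 (hb'.mono fun _ h => h.2), hx]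

/-! ### Part (iii): cofinality δ⁺ under 2^δ = δ⁺ -/

theorem mk_Iio_jOrd_le (h : (2 : Cardinal.{u}) ^ δ = Order.succ δ) :
    #(Set.Iio (U.jOrd (Order.succ δ).ord)) ≤ lift.{u + 1} (Order.succ δ) := by
  let F : (δ.ord.ToType → (Order.succ δ).ord.ToType) → Ordinal.{u} := fun f =>
    U.ordVal fun ξ => (f ξ).toOrd
  have hsub : Set.Iio (U.jOrd (Order.succ δ).ord) ⊆ Set.range F := by
    intro b hb
    obtain ⟨g, hg, rfl⟩ := U.exists_ordVal_of_lt hb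
    have hpos : (0 : Ordinal.{u}) < (Order.succ δ).ord := by simp
    refine ⟨fun ξ => Ordinal.ToType.mk (if hξ : g ξ < (Order.succ δ).ord then ⟨g ξ, hξ⟩
      else ⟨0, hpos⟩), U.ordVal_eq_iff.2 ?_⟩
    filter_upwards [hg] with ξ hξ
    simp [hξ]
  have h1 := mk_range_le_lift (f := F)
  rw [lift_id'.{u, u + 1}] at h1
  refine (mk_le_mk_of_subset hsub).trans (h1.trans ?_)
  rw [Cardinal.lift_le, ← power_def, mk_ord_toType, mk_ord_toType, ← h, ← power_mul,
    mul_eq_self U.aleph0_lt.le]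

theorem exists_fresh_of_cof_eq (h2 : (2 : Cardinal.{u}) ^ δ = Order.succ δ) {l : Ordinal.{u}}
    (hcof : l.cof = Order.succ δ) :
    ∃ A : ZFSet.{u}, IsUnboundedSubset A l.toZFSet ∧ FreshOver U.Ult A := by
  obtain ⟨f, hf⟩ := Ordinal.exists_isFundamentalSeq (o := l) (congrArg ord hcof)
  by_contra hfresh
  let A : Set Ordinal.{u} := Set.range fun i => (f i : Ordinal.{u})
  have hinj : Function.Injective fun i => (f i : Ordinal.{u}) :=
    Subtype.coe_injective.comp hf.strictMono.injective
  have hAl : A ⊆ Set.Iio l := by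
    rintro _ ⟨i, rfl⟩
    exact (f i).2
  have hmk : #A = lift.{u + 1} (Order.succ δ) := by
    rw [mk_range_eq _ hinj, mk_Iio_ordinal, card_ord]
  have hseg : ∀ c < l, #↥(A ∩ Set.Iio c) ≤ lift.{u + 1} δ := by
    intro c hc
    obtain ⟨_, ⟨i, rfl⟩, hi⟩ := hf.isCofinal_range ⟨c, hc⟩
    have hle : #(Set.Iio i) ≤ lift.{u + 1} δ := by
      have h1 : #(Set.Iio i) ≤ #(Set.Iio i.1) :=
        mk_le_of_injective (f := fun x : Set.Iio i => (⟨x.1.1, x.2⟩ : Set.Iio i.1))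
          fun x y hxy => by simpa [Subtype.ext_iff] using hxy
      refine h1.trans ?_
      rw [mk_Iio_ordinal, Cardinal.lift_le]
      exact Order.lt_succ_iff.1 (lt_ord.1 i.2)
    refine ((mk_le_mk_of_subset ?_).trans
      (mk_image_le (f := fun i => (f i : Ordinal.{u})) (s := Set.Iio i))).trans hle
    rintro _ ⟨⟨k, rfl⟩, hk⟩
    exact ⟨k, hf.strictMono.lt_iff_lt.1 (lt_of_lt_of_le (b := (⟨c, hc⟩ : Set.Iio l)) hk hi), rfl⟩
  -- Initial segments of B are small, hence internal. A non-internal B would thus be unbounded,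
  -- hence fresh.
  have hall : ∀ B ⊆ A, U.Internal B := fun B hB => by
    have hint : ∀ c < l, U.Internal (B ∩ Set.Iio c) := fun c hc => U.internal_of_mk_le
      ((mk_le_mk_of_subset (Set.inter_subset_inter_left _ hB)).trans (hseg c hc))
    by_contra hn
    refine hfresh (exists_fresh_of_not_internal (hB.trans hAl) (fun c hc => ?_) hint hn)
    by_contra! hc'
    have := hint c hc
    rw [Set.inter_eq_left.2 (show B ⊆ Set.Iio c from hc')] at this
    exact hn this
  have hinf : A.Infinite := by
    rw [← Set.infinite_coe_iff, infinite_iff, hmk, aleph0_le_lift]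
    exact U.aleph0_lt.le.trans (Order.le_succ δ)
  obtain ⟨t, ht⟩ := exists_image_eq ⟨_, U.succ_ord_lt_jOrd⟩
    ((mk_Iio_jOrd_le (U := U) h2).trans hmk.ge)
  obtain ⟨T, hT⟩ := exists_represents_map hall hinf hAl ht
  obtain ⟨S, hS⟩ := hall A subset_rfl
  -- Since t is onto j(δ⁺), almost every T(ξ) covers δ⁺: missed values g(ξ) would represent an
  -- ordinal that t misses.
  have hsurj : ∀ᶠ ξ in U.filter, Set.Iio (Order.succ δ).ord ⊆ T ξ '' S ξ := by
    by_contra hc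
    have hg : ∀ ξ, ∃ x, ¬ (Set.Iio (Order.succ δ).ord ⊆ T ξ '' S ξ) →
        x < (Order.succ δ).ord ∧ x ∉ T ξ '' S ξ := fun ξ => by
      by_cases h : Set.Iio (Order.succ δ).ord ⊆ T ξ '' S ξ
      · exact ⟨0, fun h' => (h' h).elim⟩
      · obtain ⟨x, hx⟩ := Set.not_subset.1 h
        exact ⟨x, fun _ => hx⟩
    choose g hg using hg
    have hg' := (Ultrafilter.eventually_not.2 hc).mono hg
    obtain ⟨x, hx, hxg⟩ : U.ordVal g ∈ t '' A :=
      ht ▸ U.ordVal_lt_iff.2 (hg'.mono fun _ h => h.1)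
    obtain ⟨k, rfl⟩ := U.exists_ordVal x
    rw [← hT k hx, ordVal_eq_iff] at hxg
    obtain ⟨ξ, h1, h3, h4⟩ := (hxg.and (hg'.and ((hS k).1 hx))).exists
    exact h3.2 ⟨_, h4, h1⟩
  obtain ⟨ξ, h1, h3⟩ := (hsurj.and (Represents.eventually_mk_le hS hAl hseg)).exists
  have h4 := (mk_le_mk_of_subset h1).trans (mk_image_le.trans h3)
  rw [mk_Iio_ordinal, card_ord, Cardinal.lift_le] at h4
  exact (Order.lt_succ δ).not_ge h4

end NormalUltrafilter

end MeasurableUltrapower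

end

theorem mainTheorem12 {δ : Cardinal.{u}} (U : MeasurableUltrapower.NormalUltrafilter δ) :
    (∀ κ : Cardinal.{u},
      IsLeast {μ : Cardinal.{u} | δ < μ ∧ ¬ ∀ x ∈ μ.ord.toZFSet.powerset, x ∈ U.Ult} κ →
      ∃ A : ZFSet.{u}, MeasurableUltrapower.IsUnboundedSubset A κ.ord.toZFSet ∧
        MeasurableUltrapower.FreshOver U.Ult A) ∧
    (∀ l : Ordinal.{u}, Order.IsSuccLimit l →
      MeasurableUltrapower.IsCofinalityIn U.Ult l.toZFSet (U.j (Order.succ δ).ord.toZFSet) →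
      ∃ A : ZFSet.{u}, MeasurableUltrapower.IsUnboundedSubset A l.toZFSet ∧
        MeasurableUltrapower.FreshOver U.Ult A) ∧
    ((2 : Cardinal.{u}) ^ δ = Order.succ δ →
      ∀ l : Ordinal.{u}, Order.IsSuccLimit l → l.cof = Order.succ δ →
      ∃ A : ZFSet.{u}, MeasurableUltrapower.IsUnboundedSubset A l.toZFSet ∧
        MeasurableUltrapower.FreshOver U.Ult A) := by
  exact ⟨fun _ => MeasurableUltrapower.NormalUltrafilter.exists_fresh_of_isLeast,
    fun _ => MeasurableUltrapower.NormalUltrafilter.exists_fresh_of_isCofinalityIn,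
    fun h _ _ => MeasurableUltrapower.NormalUltrafilter.exists_fresh_of_cof_eq h⟩
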